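/- Let $a, b$ be integers with $0 < a \le b$ and $a^2 \equiv a \pmod b$, and let $M = M_{a,b} = \{a, a+b, a+2b, \dots\} \cup \{1\}$ be the corresponding arithmetical congruence monoid (ACM) under multiplication. Assume that $M$ is local singular, that is, $\gcd(a,b) = p^{\alpha}$ for a prime $p$ and an integer $\alpha \ge 1$, and let $\beta$ be the smallest positive integer with $p^{\beta} \in M$. For $x \in M$ let $\mathsf{L}(x)$ be the set of all lengths of factorizations of $x$ into atoms of $M$, let $M^{\mathrm{LI}}$ be the set of those $x \in M$ with $\max \mathsf{L}(x) \ne \min \mathsf{L}(x)$, and define the length density of $M$ as $$\mathrm{LD}(M) = \inf\left\{ \frac{|\mathsf{L}(x)| - 1}{\max \mathsf{L}(x) - \min \mathsf{L}(x)} \;:\; x \in M^{\mathrm{LI}} \right\}.$$ If $\alpha \neq \beta$, then $M^{\mathrm{LI}}$ is non-empty, the largest integer $\delta(\alpha,\beta)$ that is strictly less than $\beta/\alpha$ is positive, and $$\mathrm{LD}(M) = \frac{1}{\delta(\alpha,\beta)}.$$ -/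

import Mathlib

/-- The arithmetical congruence monoid `M_{a,b} = (a + b ℕ₀) ∪ {1}`, a multiplicative submonoid of
`ℕ`, where `a² ≡ a (mod b)`. -/
def ACM (a b : ℕ) (hmul : a ^ 2 ≡ a [MOD b]) : Submonoid ℕ where
  carrier := {x | x = 1 ∨ ∃ k : ℕ, x = a + b * k}
  one_mem' := Or.inl rfl
  mul_mem' := by
    rintro x y (rfl | ⟨k, rfl⟩) (rfl | ⟨l, rfl⟩)
    · simp
    · right; exact ⟨l, by simp⟩
    · right; exact ⟨k, by simp⟩
    · right
      have hle : a ≤ a ^ 2 := Nat.le_self_pow two_ne_zero a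
      obtain ⟨t, ht⟩ := (Nat.modEq_iff_dvd' hle).1 hmul.symm
      have h2 : a ^ 2 = a + b * t := by omega
      refine ⟨t + a * l + k * a + b * k * l, ?_⟩
      calc (a + b * k) * (a + b * l) = a ^ 2 + b * (a * l + k * a + b * k * l) := by ring
        _ = _ := by rw [h2]; ring

section Factorization

variable {M : Type*} [CommMonoid M]

/-- The set `L(x)` of lengths of factorizations of `x` into atoms, a factorization being a finite
multiset of atoms whose product is `x` up to a unit. -/
def lengthSet (x : M) : Set ℕ :=
  {n | ∃ s : Multiset M, (∀ u ∈ s, Irreducible u) ∧ Associated s.prod x ∧ s.card = n}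

/-- `min L(x)`. -/
noncomputable def minLength (x : M) : ℕ := sInf (lengthSet x)

/-- `max L(x)` (meant for elements whose set of lengths is non-empty and finite, as it is for every
element of an arithmetical congruence monoid). -/
noncomputable def maxLength (x : M) : ℕ := sSup (lengthSet x)

/-- `max L(x) - min L(x)`. -/
noncomputable def lengthSpread (x : M) : ℝ := (maxLength x : ℝ) - (minLength x : ℝ)

variable (M) in
/-- The length ideal: the elements `x` with `max L(x) - min L(x) ≠ 0`. -/
def lengthIdeal : Set M := {x | lengthSpread x ≠ 0}

/-- The length density `(|L(x)| - 1) / (max L(x) - min L(x))` of an element of the length ideal. -/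
noncomputable def elementLengthDensity (x : M) : ℝ :=
  (((lengthSet x).ncard : ℝ) - 1) / lengthSpread x

variable (M) in
/-- The length density of a monoid: the infimum of the length densities of the elements of its
length ideal. -/
noncomputable def lengthDensity : ℝ := sInf (elementLengthDensity '' lengthIdeal M)

end Factorization

/-- `β`: the smallest positive integer `k` such that `p ^ k ∈ M`. -/
noncomputable def leastExponent (M : Submonoid ℕ) (p : ℕ) : ℕ := sInf {k : ℕ | 0 < k ∧ p ^ k ∈ M}

/-- `δ(α, β)`: the largest integer less than `β / α`. -/
noncomputable def largestBelow (α β : ℕ) : ℤ := sSup {n : ℤ | (n : ℝ) < (β : ℝ) / (α : ℝ)}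

theorem isGreatest_largestBelow (α β : ℕ) :
    IsGreatest {n : ℤ | (n : ℝ) < (β : ℝ) / (α : ℝ)} (largestBelow α β) := by
  have h : IsGreatest {n : ℤ | (n : ℝ) < (β : ℝ) / (α : ℝ)} (⌈(β : ℝ) / (α : ℝ)⌉ - 1) := by
    refine ⟨?_, fun n hn => ?_⟩
    · exact Int.lt_ceil.1 (sub_one_lt ⌈(β : ℝ) / (α : ℝ)⌉)
    · have : n < ⌈(β : ℝ) / (α : ℝ)⌉ := Int.lt_ceil.2 hn
      omega
  unfold largestBelow
  rw [h.csSup_eq]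
  exact h

theorem isLeast_leastExponent {a b p α : ℕ} (ha : 0 < a) (hab : a ≤ b)
    (hmul : a ^ 2 ≡ a [MOD b]) (hp : p.Prime) (hα : 0 < α) (hd : Nat.gcd a b = p ^ α) :
    IsLeast {k : ℕ | 0 < k ∧ p ^ k ∈ ACM a b hmul} (leastExponent (ACM a b hmul) p) := by
  refine ⟨Nat.sInf_mem ?_, fun k hk => Nat.sInf_le hk⟩
  obtain ⟨c, hc⟩ : p ^ α ∣ a := hd ▸ Nat.gcd_dvd_left a b
  obtain ⟨f, hf⟩ : p ^ α ∣ b := hd ▸ Nat.gcd_dvd_right a b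
  have hpα : 0 < p ^ α := pow_pos hp.pos α
  have hf0 : 0 < f := Nat.pos_of_ne_zero (by rintro rfl; omega)
  -- `b ∣ a * (a - 1)`
  have hb : b ∣ a * (a - 1) := by
    have := (Nat.modEq_iff_dvd' (Nat.le_self_pow two_ne_zero a)).1 hmul.symm
    rwa [Nat.mul_sub_one, ← sq]
  have hcf : Nat.Coprime c f := by
    have : p ^ α * Nat.gcd c f = p ^ α * 1 := by rw [← Nat.gcd_mul_left, ← hc, ← hf, hd, mul_one]
    exact Nat.eq_of_mul_eq_mul_left hpα this
  have hfa : f ∣ a - 1 := by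
    rw [hf, hc, mul_assoc] at hb
    have := Nat.dvd_of_mul_dvd_mul_left hpα hb
    rw [← hc] at this
    exact hcf.symm.dvd_of_dvd_mul_left this
  have ha1 : a ≡ 1 [MOD f] := ((Nat.modEq_iff_dvd' ha).2 hfa).symm
  have haf : Nat.Coprime a f := by
    have h := ha1.gcd_eq
    rw [Nat.gcd_one_left] at h
    exact h
  have hpf : Nat.Coprime (p ^ α) f := Nat.Coprime.coprime_dvd_left ⟨c, hc⟩ haf
  have hφ : 0 < Nat.totient f := Nat.totient_pos.2 hf0
  refine ⟨α * Nat.totient f, Nat.mul_pos hα hφ, Or.inr ?_⟩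
  have h1 : p ^ (α * Nat.totient f) ≡ a [MOD f] := by
    rw [pow_mul]; exact (Nat.ModEq.pow_totient hpf).trans ha1.symm
  have h2 : p ^ (α * Nat.totient f) ≡ a [MOD p ^ α] :=
    ((Nat.modEq_zero_iff_dvd.2 (pow_dvd_pow p (Nat.le_mul_of_pos_right α hφ)))).trans
      (Nat.modEq_zero_iff_dvd.2 ⟨c, hc⟩).symm
  have h3 : p ^ (α * Nat.totient f) ≡ a [MOD b] := by
    rw [hf]; exact (Nat.modEq_and_modEq_iff_modEq_mul hpf).1 ⟨h2, h1⟩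
  have h4 : a ≤ p ^ (α * Nat.totient f) := by
    by_contra! hlt
    have hdv := (Nat.modEq_iff_dvd' hlt.le).1 h3
    have hpos : 0 < p ^ (α * Nat.totient f) := pow_pos hp.pos _
    have := Nat.le_of_dvd (by omega) hdv
    omega
  obtain ⟨k, hk⟩ := (Nat.modEq_iff_dvd' h4).1 h3.symm
  exact ⟨k, by omega⟩

/-! Write `b = p ^ α * f`. Away from `1`, `M` consists of the positive multiples of `p ^ α`
congruent to `1` modulo `f`, and `f` is prime to `p`. With `v` the `p`-adic valuation, non-identity
elements have `v ≥ α`, and the atom `p ^ β` divides everything with `v ≥ α + β`, so atoms have `v <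
α + β`. Let `d` be the largest integer below `β / α`, so `α * d < β ≤ α * (d + 1)`.

Lower bound: gaps in length sets are at most `d` (`exists_length_near`). Extracting `p ^ β` from a
factorization shortens it by at most `d` and lengthens it by at most `d - 1`. Hence a short and a
long factorization separated by a larger gap stay on their own sides while `p ^ β` is extracted as
often as possible, and comparing valuations at the end is contradictory.

Sharpness: Dirichlet's theorem gives a prime `q ≠ p` with `A = p ^ α * q` in `M`, and `A ^ (d + 2)`
has length set `{2, d + 2}` (`exists_lengthSet_eq`). The infimum is therefore attained there. -/

/-- A valuation on a commutative monoid that is at least `α` away from the identity, together with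
an atom of valuation `β` dividing every element of valuation at least `α + β`. -/
structure AtomExtraction (M : Type*) [CommMonoid M] (α β : ℕ) where
  val : M → ℕ
  atom : M
  val_mul : ∀ x y, val (x * y) = val x + val y
  le_val : ∀ x, x ≠ 1 → α ≤ val x
  val_atom : val atom = β
  irreducible_atom : Irreducible atom
  atom_dvd : ∀ x, α + β ≤ val x → atom ∣ x

/-! ### Valuation bounds on atoms and lengths. -/

namespace AtomExtraction

variable {M : Type*} [CommMonoid M] {α β : ℕ}

theorem val_one (E : AtomExtraction M α β) : E.val 1 = 0 := by
  have := E.val_mul 1 1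
  rw [mul_one] at this
  omega

theorem val_pow (E : AtomExtraction M α β) (x : M) (n : ℕ) : E.val (x ^ n) = n * E.val x := by
  induction n with
  | zero => simp [E.val_one]
  | succ n ih => rw [pow_succ, E.val_mul, ih, add_mul, one_mul]

theorem eq_one_of_val_lt (E : AtomExtraction M α β) {x : M} (hx : E.val x < α) : x = 1 := by
  by_contra h
  exact absurd (E.le_val x h) (by omega)

theorem eq_one_of_isUnit (E : AtomExtraction M α β) (hα : 0 < α) {x : M} (hx : IsUnit x) :
    x = 1 := by
  obtain ⟨y, hy⟩ := hx.exists_right_inv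
  have := E.val_mul x y
  rw [hy, E.val_one] at this
  exact E.eq_one_of_val_lt (by omega)

theorem associated_iff_eq (E : AtomExtraction M α β) (hα : 0 < α) {x y : M} :
    Associated x y ↔ x = y := by
  refine ⟨?_, fun h => h ▸ Associated.refl x⟩
  rintro ⟨u, rfl⟩
  rw [E.eq_one_of_isUnit hα u.isUnit, mul_one]

theorem mem_lengthSet (E : AtomExtraction M α β) (hα : 0 < α) {x : M} {n : ℕ} :
    n ∈ lengthSet x ↔
      ∃ s : Multiset M, (∀ u ∈ s, Irreducible u) ∧ s.prod = x ∧ s.card = n := by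
  simp only [lengthSet, Set.mem_ofPred_eq, E.associated_iff_eq hα]

/-- A product of two non-identity elements has valuation at least `2 * α`. -/
theorem irreducible_of_val_lt (E : AtomExtraction M α β) (hα : 0 < α) {x : M} (hx : x ≠ 1)
    (hv : E.val x < 2 * α) :
    Irreducible x := by
  refine ⟨fun h => hx (E.eq_one_of_isUnit hα h), fun y z hyz => ?_⟩
  have := E.val_mul y z
  rw [← hyz] at this
  rcases lt_or_ge (E.val y) α with h | h
  · left; rw [E.eq_one_of_val_lt h]; exact isUnit_one
  · right; rw [E.eq_one_of_val_lt (show E.val z < α by omega)]; exact isUnit_one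

theorem ne_one_of_irreducible {x : M} (hx : Irreducible x) : x ≠ 1 := by
  rintro rfl
  exact hx.not_isUnit isUnit_one

theorem val_lt_of_irreducible (E : AtomExtraction M α β) (hα : 0 < α) (hβ : 0 < β) {x : M}
    (hx : Irreducible x) :
    E.val x < α + β := by
  by_contra! h
  obtain ⟨w, rfl⟩ := E.atom_dvd x h
  have hw := E.val_mul E.atom w
  rw [E.val_atom] at hw
  rcases hx.isUnit_or_isUnit rfl with h1 | h1
  · have := E.val_atom
    rw [E.eq_one_of_isUnit hα h1, E.val_one] at this
    omega
  · rw [E.eq_one_of_isUnit hα h1, E.val_one] at hw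
    rw [E.eq_one_of_isUnit hα h1] at h
    omega

theorem card_mul_le_val (E : AtomExtraction M α β) {s : Multiset M} (hs : ∀ u ∈ s, Irreducible u) :
    s.card * α ≤ E.val s.prod := by
  induction s using Multiset.induction_on with
  | empty => simp
  | cons y t ih =>
    rw [Multiset.prod_cons, E.val_mul, Multiset.card_cons, add_mul, one_mul]
    have h1 := ih fun u hu => hs u (Multiset.mem_cons_of_mem hu)
    have h2 := E.le_val y (ne_one_of_irreducible (hs y (Multiset.mem_cons_self y t)))
    omega

theorem exists_factorization (E : AtomExtraction M α β) (hα : 0 < α) (x : M) :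
    ∃ s : Multiset M, (∀ u ∈ s, Irreducible u) ∧ s.prod = x := by
  induction h : E.val x using Nat.strong_induction_on generalizing x with
  | _ n ih =>
    by_cases hx : x = 1
    · exact ⟨0, by simp, by simp [hx]⟩
    by_cases hi : Irreducible x
    · exact ⟨{x}, by simpa using hi, by simp⟩
    have hu : ¬ IsUnit x := fun h => hx (E.eq_one_of_isUnit hα h)
    obtain ⟨y, z, hy, hz, rfl⟩ : ∃ y z, ¬ IsUnit y ∧ ¬ IsUnit z ∧ x = y * z := by
      by_contra! hc
      exact hi ⟨hu, fun y z hyz => by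
        by_contra! hcon
        exact hc y z hcon.1 hcon.2 hyz⟩
    have hy1 := E.le_val y fun h => hy (h ▸ isUnit_one)
    have hz1 := E.le_val z fun h => hz (h ▸ isUnit_one)
    have := E.val_mul y z
    obtain ⟨s, hs, rfl⟩ := ih (E.val y) (by omega) y rfl
    obtain ⟨t, ht, rfl⟩ := ih (E.val z) (by omega) z rfl
    refine ⟨s + t, fun u hu => ?_, Multiset.prod_add s t⟩
    rcases Multiset.mem_add.1 hu with h | h
    exacts [hs u h, ht u h]

theorem lengthSet_nonempty (E : AtomExtraction M α β) (hα : 0 < α) (x : M) :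
    (lengthSet x).Nonempty := by
  obtain ⟨s, hs, h⟩ := E.exists_factorization hα x
  exact ⟨s.card, (E.mem_lengthSet hα).2 ⟨s, hs, h, rfl⟩⟩

theorem le_val_of_mem_lengthSet (E : AtomExtraction M α β) (hα : 0 < α) {x : M} {n : ℕ}
    (hn : n ∈ lengthSet x) :
    n * α ≤ E.val x := by
  obtain ⟨s, hs, rfl, rfl⟩ := (E.mem_lengthSet hα).1 hn
  exact E.card_mul_le_val hs

theorem lengthSet_finite (E : AtomExtraction M α β) (hα : 0 < α) (x : M) : (lengthSet x).Finite :=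
  (Set.finite_Iic (E.val x)).subset fun _ hn =>
    (Nat.le_mul_of_pos_right _ hα).trans (E.le_val_of_mem_lengthSet hα hn)

theorem val_atom_pow_mul (E : AtomExtraction M α β) (h : ℕ) (x : M) : E.val
    (E.atom ^ h * x) = h * β + E.val x := by
  induction h with
  | zero => simp
  | succ h ih => rw [pow_succ', mul_assoc, E.val_mul, ih, E.val_atom]; ring

theorem add_mem_lengthSet (E : AtomExtraction M α β) (hα : 0 < α) {x : M} {h : ℕ} {t : Multiset M}
    (ht : ∀ u ∈ t, Irreducible u) (hx : E.atom ^ h * t.prod = x) :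
    h + t.card ∈ lengthSet x := by
  refine (E.mem_lengthSet hα).2 ⟨Multiset.replicate h E.atom + t, fun u hu => ?_, ?_, by simp⟩
  · rcases Multiset.mem_add.1 hu with hu | hu
    · rw [Multiset.eq_of_mem_replicate hu]; exact E.irreducible_atom
    · exact ht u hu
  · rw [Multiset.prod_add, Multiset.prod_replicate, hx]

/-! ### Extracting the distinguished atom and bounding gaps. -/

/-- Replacing a subproduct `s` of a factorization `t` by `atom * w`. -/
theorem exists_replace (E : AtomExtraction M α β) {s t w : Multiset M} (hst : s ≤ t)
    (ht : ∀ u ∈ t, Irreducible u)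
    (hw : ∀ u ∈ w, Irreducible u) (hs : s.prod = E.atom * w.prod) :
    ∃ t' : Multiset M, (∀ u ∈ t', Irreducible u) ∧ E.atom * t'.prod = t.prod ∧
      t'.card + s.card = t.card + w.card := by
  obtain ⟨r, rfl⟩ := Multiset.le_iff_exists_add.1 hst
  refine ⟨w + r, fun u hu => ?_, ?_, ?_⟩
  · rcases Multiset.mem_add.1 hu with hu | hu
    · exact hw u hu
    · exact ht u (Multiset.mem_add.2 (Or.inr hu))
  · rw [Multiset.prod_add, Multiset.prod_add, hs, mul_assoc]
  · simp only [Multiset.card_add]; omega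

/-- An atom can be extracted at the cost of shortening the factorization by at most `d`. -/
theorem exists_extract_ge (E : AtomExtraction M α β) (hα : 0 < α) {d : ℕ} (hd : β ≤ α * (d + 1))
    {t : Multiset M}
    (ht : ∀ u ∈ t, Irreducible u) (hv : α + β ≤ E.val t.prod) :
    ∃ t' : Multiset M, (∀ u ∈ t', Irreducible u) ∧ E.atom * t'.prod = t.prod ∧
      t.card ≤ t'.card + 1 + d := by
  -- Any `d + 2` atoms suffice, since `α * (d + 2) ≥ α + β`.
  obtain ⟨s, hst, hsc, hsv⟩ : ∃ s ≤ t, s.card ≤ d + 2 ∧ α + β ≤ E.val s.prod := by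
    rcases le_total t.card (d + 2) with h | h
    · exact ⟨t, le_rfl, h, hv⟩
    · obtain ⟨s, hs⟩ := Multiset.card_pos_iff_exists_mem.1
        (Multiset.card_powersetCard (d + 2) t ▸ Nat.choose_pos h)
      obtain ⟨hst, hs⟩ := Multiset.mem_powersetCard.1 hs
      refine ⟨s, hst, hs.le, ?_⟩
      have := E.card_mul_le_val fun u hu => ht u (Multiset.mem_of_le hst hu)
      rw [hs] at this
      nlinarith
  obtain ⟨w, hw⟩ := E.atom_dvd _ hsv
  obtain ⟨w, hwi, rfl⟩ := E.exists_factorization hα w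
  obtain ⟨t', h1, h2, h3⟩ := E.exists_replace hst ht hwi hw
  refine ⟨t', h1, h2, ?_⟩
  -- The cofactor is not `1`, its valuation being at least `α`; it contributes at least one atom.
  have : w.card ≠ 0 := by
    intro h0
    rw [Multiset.card_eq_zero.1 h0, Multiset.prod_zero, mul_one] at hw
    rw [hw, E.val_atom] at hsv
    omega
  omega

/-- Below `α + β`, more than `d + 1` factors would need too much valuation. Otherwise splitting off
`atom` leaves a cofactor of valuation below `2 * α`, hence an atom, and `2 ≤ d + 1`. -/
theorem exists_short_factorization (E : AtomExtraction M α β) (hα : 0 < α) {d : ℕ} (hd0 : 0 < d)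
    (hd : β ≤ α * (d + 1))
    {x : M} (hx : E.val x + 2 ≤ 2 * α + β) :
    ∃ s : Multiset M, (∀ u ∈ s, Irreducible u) ∧ s.prod = x ∧ s.card ≤ d + 1 := by
  rcases lt_or_ge (E.val x) (α + β) with h | h
  · obtain ⟨s, hs, rfl⟩ := E.exists_factorization hα x
    refine ⟨s, hs, rfl, ?_⟩
    have := E.card_mul_le_val hs
    by_contra! hc
    nlinarith
  · obtain ⟨w, rfl⟩ := E.atom_dvd x h
    have hv := E.val_mul E.atom w
    rw [E.val_atom] at hv
    have hw : Irreducible w := by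
      refine E.irreducible_of_val_lt hα (fun h1 => ?_) (by omega)
      rw [h1, E.val_one] at hv
      rw [h1] at h
      omega
    refine ⟨{E.atom, w}, ?_, by simp, by simp; omega⟩
    simp only [Multiset.insert_eq_cons, Multiset.mem_cons, Multiset.mem_singleton]
    rintro u (rfl | rfl)
    exacts [E.irreducible_atom, hw]

/-- An atom can be extracted at the cost of lengthening the factorization by at most `d`. -/
theorem exists_extract_le (E : AtomExtraction M α β) (hα : 0 < α) (hβ : 0 < β) {d : ℕ} (hd0 : 0 < d)
    (hd : β ≤ α * (d + 1)) {t : Multiset M} (ht : ∀ u ∈ t, Irreducible u)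
    (hv : α + β ≤ E.val t.prod) :
    ∃ t' : Multiset M, (∀ u ∈ t', Irreducible u) ∧ E.atom * t'.prod = t.prod ∧
      t'.card + 1 ≤ t.card + d := by
  -- By minimality, `s` is an atom times a product of valuation below `α + β`. So the cofactor of
  -- `atom` has valuation at most `2 * α + β - 2`, the bound in `exists_short_factorization`;
  -- moreover `s` has at least two factors.
  obtain ⟨s, ⟨hst, hsv⟩, hmin⟩ :=
    WellFounded.has_min (wellFounded_lt (α := Multiset M))
      {s | s ≤ t ∧ α + β ≤ E.val s.prod} ⟨t, le_rfl, hv⟩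
  have hsi : ∀ u ∈ s, Irreducible u := fun u hu => ht u (Multiset.mem_of_le hst hu)
  obtain ⟨y, hy⟩ : ∃ y, y ∈ s := by
    refine Multiset.exists_mem_of_ne_zero ?_
    rintro rfl
    rw [Multiset.prod_zero, E.val_one] at hsv
    omega
  obtain ⟨r, rfl⟩ := Multiset.exists_cons_of_mem hy
  have hyv := E.val_lt_of_irreducible hα hβ (hsi y hy)
  have hrv : E.val r.prod < α + β := by
    by_contra! hc
    exact hmin r ⟨(Multiset.le_cons_self r y).trans hst, hc⟩ (Multiset.lt_cons_self r y)
  have hr : r.card ≠ 0 := by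
    intro h0
    rw [Multiset.card_eq_zero.1 h0] at hsv
    simp only [Multiset.cons_zero, Multiset.prod_singleton] at hsv
    omega
  obtain ⟨w, hw⟩ := E.atom_dvd _ hsv
  have hwv := E.val_mul E.atom w
  rw [← hw, Multiset.prod_cons, E.val_mul, E.val_atom] at hwv
  obtain ⟨w, hwi, rfl, hwc⟩ := E.exists_short_factorization hα hd0 hd (x := w) (by omega)
  obtain ⟨t', h1, h2, h3⟩ := E.exists_replace hst ht hwi hw
  refine ⟨t', h1, h2, ?_⟩
  rw [Multiset.card_cons] at h3
  omega

/-- Extracting atoms as long as possible, while the length keeps a property `Q`. -/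
theorem exists_extracted (E : AtomExtraction M α β) (hβ : 0 < β) {x : M} (Q : ℕ → Prop)
    (step : ∀ (h : ℕ) (t : Multiset M), (∀ u ∈ t, Irreducible u) → E.atom ^ h * t.prod = x →
      Q (h + t.card) → α + β ≤ E.val t.prod →
      ∃ t' : Multiset M, (∀ u ∈ t', Irreducible u) ∧ E.atom * t'.prod = t.prod ∧
        Q (h + 1 + t'.card))
    (h : ℕ) (t : Multiset M) (ht : ∀ u ∈ t, Irreducible u) (hx : E.atom ^ h * t.prod = x)
    (hQ : Q (h + t.card)) :
    ∃ (h : ℕ) (t : Multiset M), (∀ u ∈ t, Irreducible u) ∧ E.atom ^ h * t.prod = x ∧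
      Q (h + t.card) ∧ E.val t.prod < α + β := by
  induction hn : E.val t.prod using Nat.strong_induction_on generalizing h t with
  | _ n ih =>
    rcases lt_or_ge (E.val t.prod) (α + β) with hlt | hge
    · exact ⟨h, t, ht, hx, hQ, hlt⟩
    · obtain ⟨t', h1, h2, h3⟩ := step h t ht hx hQ hge
      have hv := E.val_mul E.atom t'.prod
      rw [h2, E.val_atom] at hv
      exact ih _ (by omega) (h + 1) t' h1 (by rw [pow_succ, mul_assoc, h2, hx]) h3 rfl

/-- Consecutive lengths of an element differ by at most `d`. -/
theorem exists_length_near (E : AtomExtraction M α β) (hα : 0 < α) (hαβ : α < β) {d : ℕ}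
    (hd0 : 0 < d)
    (hd : β ≤ α * (d + 1)) {x : M} {m n : ℕ} (hm : m ∈ lengthSet x) (hn : n ∈ lengthSet x)
    (hmn : m < n) : ∃ l ∈ lengthSet x, m < l ∧ l ≤ m + d := by
  by_contra! hgap
  have hβ : 0 < β := hα.trans hαβ
  obtain ⟨s, hs, hsx, rfl⟩ := (E.mem_lengthSet hα).1 hm
  obtain ⟨r, hr, hrx, rfl⟩ := (E.mem_lengthSet hα).1 hn
  -- An extraction adds less than `d` to the length, so it cannot jump the gap upwards.
  obtain ⟨j, t, ht, htx, htQ, htv⟩ := E.exists_extracted hβ (x := x) (fun l => l ≤ s.card)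
    (fun h t ht hx hQ hv => by
      obtain ⟨t', h1, h2, h3⟩ := E.exists_extract_le hα hβ hd0 hd ht hv
      refine ⟨t', h1, h2, ?_⟩
      by_contra! hc
      have := hgap _ (E.add_mem_lengthSet hα (h := h + 1) h1
        (by rw [pow_succ, mul_assoc, h2, hx])) hc
      omega) 0 s hs (by simpa using hsx) (by simp)
  -- Lengths above the gap exceed `s.card + d`, so losing `d` cannot cross it downwards.
  obtain ⟨h, q, hq, hqx, hqQ, hqv⟩ := E.exists_extracted hβ (x := x) (fun l => s.card < l)
    (fun h t ht hx hQ hv => by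
      obtain ⟨t', h1, h2, h3⟩ := E.exists_extract_ge hα hd ht hv
      refine ⟨t', h1, h2, ?_⟩
      have := hgap _ (E.add_mem_lengthSet hα ht hx) hQ
      omega) 0 r hr (by simpa using hrx) (by simpa using hmn)
  have hfar := hgap _ (E.add_mem_lengthSet hα hq hqx) hqQ
  have e1 := E.val_atom_pow_mul j t.prod
  have e2 := E.val_atom_pow_mul h q.prod
  rw [htx] at e1
  rw [hqx] at e2
  have c2 := E.card_mul_le_val hq
  have hqc : q.card ≤ d + 1 := by
    by_contra! hc
    nlinarith
  -- The long side has total length at least `s.card + d + 1`, of which `q` supplies at most `d +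
  -- 1`. If `t` is empty, valuations force `q` empty too. Otherwise `h = j + 1`, and `q` has `d + 1`
  -- atoms but valuation below `α`.
  have hhj : j + t.card ≤ h := by omega
  rcases Nat.eq_zero_or_pos t.card with h0 | hpos
  · rw [Multiset.card_eq_zero.1 h0, Multiset.prod_zero, E.val_one] at e1
    have hle : h ≤ j := by
      by_contra! hc
      nlinarith
    have hhj' : h = j := by omega
    subst hhj'
    have : q.card * α = 0 := by omega
    rcases Nat.mul_eq_zero.1 this with h | h <;> omega
  · have hle : h ≤ j + 1 := by
      by_contra! hc
      nlinarith
    have hh : h = j + 1 := by omega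
    have hqd : q.card = d + 1 := by omega
    rw [hqd] at c2
    subst hh
    nlinarith

end AtomExtraction

/-! ### From bounded gaps to length density. -/

/-- A finite set of natural numbers whose gaps are at most `d` and whose least and greatest
elements are `m` and `n` has at least `(n - m) / d + 1` elements. -/
theorem Finset.sub_le_mul_card_of_gaps_le {T : Finset ℕ} {d m n : ℕ} (hm : m ∈ T) (hn : n ∈ T)
    (hgap : ∀ k ∈ T, k < n → ∃ l ∈ T, k < l ∧ l ≤ k + d) :
    n - m ≤ d * (T.card - 1) := by
  -- Each `i` lies less than `d` above the largest element of `T` not exceeding `i`.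
  have hsub : Finset.Ico m n ⊆ (T.erase n).biUnion fun k => Finset.Ico k (k + d) := by
    intro i hi
    obtain ⟨hmi, hin⟩ := Finset.mem_Ico.1 hi
    obtain ⟨k, hk, hmax⟩ := (T.filter (· ≤ i)).exists_max_image id
      ⟨m, Finset.mem_filter.2 ⟨hm, hmi⟩⟩
    obtain ⟨hkT, hki⟩ := Finset.mem_filter.1 hk
    obtain ⟨l, hl, hkl, hld⟩ := hgap k hkT (by omega)
    refine Finset.mem_biUnion.2 ⟨k, Finset.mem_erase.2 ⟨by omega, hkT⟩, Finset.mem_Ico.2 ⟨hki, ?_⟩⟩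
    by_contra! hc
    have : l ≤ k := hmax l (Finset.mem_filter.2 ⟨hl, by omega⟩)
    omega
  calc n - m = (Finset.Ico m n).card := (Nat.card_Ico m n).symm
    _ ≤ _ := Finset.card_le_card hsub
    _ ≤ (T.erase n).card * d := Finset.card_biUnion_le_card_mul _ _ _ fun k _ => by simp
    _ = d * (T.card - 1) := by rw [Finset.card_erase_of_mem hn, mul_comm]

namespace AtomExtraction

variable {M : Type*} [CommMonoid M] {α β : ℕ}

theorem le_elementLengthDensity (E : AtomExtraction M α β) (hα : 0 < α) (hαβ : α < β) {d : ℕ}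
    (hd0 : 0 < d) (hd : β ≤ α * (d + 1)) {x : M} (hx : x ∈ lengthIdeal M) :
    1 / (d : ℝ) ≤ elementLengthDensity x := by
  have hfin := E.lengthSet_finite hα x
  have hne := E.lengthSet_nonempty hα x
  have hmin : minLength x ∈ lengthSet x := Nat.sInf_mem hne
  have hmax : maxLength x ∈ lengthSet x := Nat.sSup_mem hne hfin.bddAbove
  have hle : minLength x ≤ maxLength x := Nat.sInf_le hmax
  have hcard := Finset.sub_le_mul_card_of_gaps_le (T := hfin.toFinset) (d := d)
    (hfin.mem_toFinset.2 hmin) (hfin.mem_toFinset.2 hmax) fun k hk hlt => by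
      obtain ⟨l, hl, h⟩ :=
        E.exists_length_near hα hαβ hd0 hd (hfin.mem_toFinset.1 hk) hmax hlt
      exact ⟨l, hfin.mem_toFinset.2 hl, h⟩
  rw [← Set.ncard_eq_toFinset_card _ hfin] at hcard
  have hpos : 0 < (lengthSet x).ncard := (Set.ncard_pos hfin).2 hne
  have hspread : 0 < lengthSpread x := by
    refine lt_of_le_of_ne ?_ (Ne.symm hx)
    simpa [lengthSpread] using hle
  have hreal : lengthSpread x ≤ d * (((lengthSet x).ncard : ℝ) - 1) := by
    have : ((maxLength x - minLength x : ℕ) : ℝ) ≤ ((d * ((lengthSet x).ncard - 1) : ℕ) : ℝ) :=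
      Nat.cast_le.2 hcard
    rwa [Nat.cast_sub hle, Nat.cast_mul, Nat.cast_sub hpos, Nat.cast_one] at this
  rw [elementLengthDensity, div_le_div_iff₀ (by exact_mod_cast hd0) hspread]
  linarith

/-- If gaps are at most `d` and some set of lengths is `{2, d + 2}`, the length density is
`1 / d`. -/
theorem lengthDensity_eq (E : AtomExtraction M α β) (hα : 0 < α) (hαβ : α < β) {d : ℕ}
    (hd0 : 0 < d) (hd : β ≤ α * (d + 1)) {x : M} (hx : lengthSet x = {2, d + 2}) :
    (lengthIdeal M).Nonempty ∧ lengthDensity M = 1 / (d : ℝ) := by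
  have hmin : minLength x = 2 := by
    rw [minLength, hx, csInf_pair]; simp
  have hmax : maxLength x = d + 2 := by
    rw [maxLength, hx, csSup_pair]; simp
  have hspread : lengthSpread x = d := by
    simp [lengthSpread, hmin, hmax]
  have hmem : x ∈ lengthIdeal M := by
    change lengthSpread x ≠ 0
    rw [hspread]
    exact_mod_cast hd0.ne'
  refine ⟨⟨x, hmem⟩, IsLeast.csInf_eq ⟨⟨x, hmem, ?_⟩, ?_⟩⟩
  · rw [elementLengthDensity, hspread, hx, Set.ncard_pair (by omega)]
    norm_num
  · rintro _ ⟨y, hy, rfl⟩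
    exact E.le_elementLengthDensity hα hαβ hd0 hd hy

end AtomExtraction

/-! ### Arithmetic of local singular congruence monoids. -/

/-- Away from `1`, a local singular arithmetical congruence monoid consists of the positive
multiples of `p ^ α` that are congruent to `1` modulo the part of `b` coprime to `p`. -/
theorem exists_mem_ACM_iff {a b p α : ℕ} (ha : 0 < a) (hab : a ≤ b)
    (hmul : a ^ 2 ≡ a [MOD b]) (hp : p.Prime) (hα : 0 < α) (hd : Nat.gcd a b = p ^ α) :
    ∃ f : ℕ, 0 < f ∧ Nat.Coprime p f ∧
      ∀ x, x ∈ ACM a b hmul ↔ x = 1 ∨ (0 < x ∧ p ^ α ∣ x ∧ x ≡ 1 [MOD f]) := by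
  obtain ⟨c, hc⟩ : p ^ α ∣ a := hd ▸ Nat.gcd_dvd_left a b
  obtain ⟨f, hf⟩ : p ^ α ∣ b := hd ▸ Nat.gcd_dvd_right a b
  have hpα : 0 < p ^ α := pow_pos hp.pos α
  have hf0 : 0 < f := Nat.pos_of_ne_zero (by rintro rfl; omega)
  have hb : b ∣ a * (a - 1) := by
    have := (Nat.modEq_iff_dvd' (Nat.le_self_pow two_ne_zero a)).1 hmul.symm
    rwa [Nat.mul_sub_one, ← sq]
  have hcf : Nat.Coprime c f := by
    have : p ^ α * Nat.gcd c f = p ^ α * 1 := by rw [← Nat.gcd_mul_left, ← hc, ← hf, hd, mul_one]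
    exact Nat.eq_of_mul_eq_mul_left hpα this
  have hfa : f ∣ a - 1 := by
    rw [hf, hc, mul_assoc] at hb
    have := Nat.dvd_of_mul_dvd_mul_left hpα hb
    rw [← hc] at this
    exact hcf.symm.dvd_of_dvd_mul_left this
  have ha1 : a ≡ 1 [MOD f] := ((Nat.modEq_iff_dvd' ha).2 hfa).symm
  have haf : Nat.Coprime a f := by
    have h := ha1.gcd_eq
    rw [Nat.gcd_one_left] at h
    exact h
  have hpf : Nat.Coprime (p ^ α) f := Nat.Coprime.coprime_dvd_left ⟨c, hc⟩ haf
  refine ⟨f, hf0, (Nat.coprime_pow_left_iff hα p f).1 hpf, fun x => or_congr_right ?_⟩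
  -- Chinese remainder theorem: `a` is `0` modulo `p ^ α` and `1` modulo `f`.
  have key : x ≡ a [MOD b] ↔ p ^ α ∣ x ∧ x ≡ 1 [MOD f] := by
    have h0 : a ≡ 0 [MOD p ^ α] := Nat.modEq_zero_iff_dvd.2 ⟨c, hc⟩
    rw [hf, ← Nat.modEq_and_modEq_iff_modEq_mul hpf, ← Nat.modEq_zero_iff_dvd]
    exact ⟨fun h => ⟨h.1.trans h0, h.2.trans ha1⟩,
      fun h => ⟨h.1.trans h0.symm, h.2.trans ha1.symm⟩⟩
  rw [← key]
  constructor
  · rintro ⟨k, rfl⟩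
    exact ⟨by omega, by simp [Nat.ModEq]⟩
  · rintro ⟨hx, h⟩
    have hax : a ≤ x := by
      by_contra! hlt
      have := Nat.le_of_dvd (by omega) ((Nat.modEq_iff_dvd' hlt.le).1 h)
      omega
    obtain ⟨k, hk⟩ := (Nat.modEq_iff_dvd' hax).1 h.symm
    exact ⟨k, by omega⟩

section LocalSingular

variable {N : Submonoid ℕ} {p α β f : ℕ}

theorem ne_zero_of_mem (hN : ∀ x, x ∈ N ↔ x = 1 ∨ (0 < x ∧ p ^ α ∣ x ∧ x ≡ 1 [MOD f]))
    (x : N) : (x : ℕ) ≠ 0 := by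
  rcases (hN x).1 x.2 with h | h <;> omega

theorem modEq_one_of_mem (hN : ∀ x, x ∈ N ↔ x = 1 ∨ (0 < x ∧ p ^ α ∣ x ∧ x ≡ 1 [MOD f]))
    {x : ℕ} (hx : x ∈ N) : x ≡ 1 [MOD f] := by
  rcases (hN x).1 hx with rfl | h
  exacts [rfl, h.2.2]

theorem dvd_of_mem (hN : ∀ x, x ∈ N ↔ x = 1 ∨ (0 < x ∧ p ^ α ∣ x ∧ x ≡ 1 [MOD f]))
    {x : ℕ} (hx : x ∈ N) (h1 : x ≠ 1) : p ^ α ∣ x := by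
  rcases (hN x).1 hx with h | h
  exacts [absurd h h1, h.2.1]

theorem modEq_one_of_mul_modEq_one {x y : ℕ} (hx : x ≡ 1 [MOD f]) (hxy : x * y ≡ 1 [MOD f]) :
    y ≡ 1 [MOD f] := by
  have := (hx.mul_right y).symm.trans hxy
  rwa [one_mul] at this

theorem isUnit_of_coe_eq_one {x : N} (hx : (x : ℕ) = 1) : IsUnit x := by
  rw [show x = 1 from Subtype.ext hx]
  exact isUnit_one

theorem irreducible_pow_leastExponent (hp : p.Prime)
    (hβ : IsLeast {k : ℕ | 0 < k ∧ p ^ k ∈ N} β) :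
    Irreducible (⟨p ^ β, hβ.1.2⟩ : N) := by
  have hunit : ∀ x : N, IsUnit x → (x : ℕ) = 1 := fun x hx =>
    Nat.isUnit_iff.1 (hx.map N.subtype)
  refine ⟨fun h => ?_, fun y z hyz => ?_⟩
  · exact (Nat.one_lt_pow hβ.1.1.ne' hp.one_lt).ne' (hunit _ h)
  · have hyz' : p ^ β = (y : ℕ) * z := congrArg Subtype.val hyz
    obtain ⟨i, hi, hy⟩ := (Nat.dvd_prime_pow hp).1 (Dvd.intro _ hyz'.symm)
    obtain ⟨j, hj, hz⟩ := (Nat.dvd_prime_pow hp).1 (Dvd.intro_left _ hyz'.symm)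
    rcases Nat.eq_zero_or_pos i with rfl | hi0
    · exact Or.inl (isUnit_of_coe_eq_one (by simpa using hy))
    rcases Nat.eq_zero_or_pos j with rfl | hj0
    · exact Or.inr (isUnit_of_coe_eq_one (by simpa using hz))
    have h1 : β ≤ i := hβ.2 ⟨hi0, hy ▸ y.2⟩
    have h2 : β ≤ j := hβ.2 ⟨hj0, hz ▸ z.2⟩
    rw [hy, hz, ← pow_add] at hyz'
    have := Nat.pow_right_injective hp.two_le hyz'
    have := hβ.1.1
    omega

/-- In a local singular arithmetical congruence monoid the atom `p ^ β` divides every element of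
`p`-adic valuation at least `α + β`. -/
noncomputable def localSingularExtraction (hp : p.Prime)
    (hN : ∀ x, x ∈ N ↔ x = 1 ∨ (0 < x ∧ p ^ α ∣ x ∧ x ≡ 1 [MOD f]))
    (hβ : IsLeast {k : ℕ | 0 < k ∧ p ^ k ∈ N} β) : AtomExtraction N α β where
  val x := (x : ℕ).factorization p
  atom := ⟨p ^ β, hβ.1.2⟩
  val_mul x y := by
    rw [Submonoid.coe_mul, Nat.factorization_mul (ne_zero_of_mem hN x) (ne_zero_of_mem hN y)]
    rfl
  le_val x hx := (hp.pow_dvd_iff_le_factorization (ne_zero_of_mem hN x)).1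
    (dvd_of_mem hN x.2 fun h => hx (Subtype.ext h))
  val_atom := by simp [hp.factorization]
  irreducible_atom := irreducible_pow_leastExponent hp hβ
  atom_dvd x hx := by
    obtain ⟨w, hw⟩ := (hp.pow_dvd_iff_le_factorization (ne_zero_of_mem hN x)).2 hx
    have hx1 := modEq_one_of_mem hN x.2
    have hw' : (x : ℕ) = p ^ β * (p ^ α * w) := by rw [hw, pow_add]; ring
    have hpos : 0 < p ^ α * w := Nat.pos_of_ne_zero fun h =>
      ne_zero_of_mem hN x (by rw [hw', h, mul_zero])
    -- The cofactor keeps a factor `p ^ α`, and is `1` modulo `f` because `p ^ β` is.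
    refine ⟨⟨p ^ α * w, (hN _).2 (Or.inr ⟨hpos, Dvd.intro _ rfl, ?_⟩)⟩, Subtype.ext hw'⟩
    rw [hw'] at hx1
    exact modEq_one_of_mul_modEq_one (modEq_one_of_mem hN hβ.1.2) hx1

theorem exists_prime_pow_mul_modEq_one (hf : 0 < f) (hpf : Nat.Coprime p f) :
    ∃ q, q.Prime ∧ p ≠ q ∧ p ^ α * q ≡ 1 [MOD f] := by
  have : NeZero f := ⟨hf.ne'⟩
  have hu : IsUnit ((p ^ α : ℕ) : ZMod f) :=
    (ZMod.isUnit_iff_coprime _ _).2 (hpf.pow_left α)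
  obtain ⟨q, hgt, hq, hqf⟩ := Nat.forall_exists_prime_gt_and_eq_mod (hu.unit⁻¹).isUnit p
  refine ⟨q, hq, hgt.ne, ?_⟩
  rw [← ZMod.natCast_eq_natCast_iff, Nat.cast_mul, hqf, Nat.cast_one]
  exact hu.mul_val_inv

/-- If `m ≥ α`, then `p ^ m` is in the monoid. If `m < α`, some multiple of `m` lies in `[α, 2 * α)`
and is the exponent of a power of `p` in the monoid, contradicting `2 * α ≤ β`. -/
theorem le_of_pow_modEq_one
    (hN : ∀ x, x ∈ N ↔ x = 1 ∨ (0 < x ∧ p ^ α ∣ x ∧ x ≡ 1 [MOD f])) (hp : p.Prime)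
    (hβ : IsLeast {k : ℕ | 0 < k ∧ p ^ k ∈ N} β) (h2 : 2 * α ≤ β) {m : ℕ} (hm : 0 < m)
    (hpm : p ^ m ≡ 1 [MOD f]) : β ≤ m := by
  have hmem : ∀ k, α ≤ m * k → p ^ (m * k) ∈ N := fun k hk =>
    (hN _).2 (Or.inr ⟨pow_pos hp.pos _, pow_dvd_pow p hk, by
      rw [pow_mul]; simpa using hpm.pow k⟩)
  rcases le_or_gt α m with h | h
  · exact hβ.2 ⟨hm, by simpa using hmem 1 (by simpa using h)⟩
  · exfalso
    have h1 := Nat.div_add_mod α m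
    have h3 := Nat.mod_lt α hm
    have h4 : β ≤ m * (α / m + 1) :=
      hβ.2 ⟨by positivity, hmem _ (by rw [mul_add, mul_one]; omega)⟩
    rw [mul_add, mul_one] at h4
    omega

end LocalSingular

/-! ### The extremal element `A ^ (d + 2)`. -/

namespace AtomExtraction

variable {M : Type*} [CommMonoid M] {α β : ℕ}

theorem two_mem_lengthSet_pow (E : AtomExtraction M α β) (hα : 0 < α) (hαβ : α < β)
    {d : ℕ} (hd : β ≤ α * (d + 1)) (hd' : α * d < β) {A : M} (hA : E.val A = α) :
    2 ∈ lengthSet (A ^ (d + 2)) ∧ d + 2 ∈ lengthSet (A ^ (d + 2)) ∧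
      ∀ n ∈ lengthSet (A ^ (d + 2)), 2 ≤ n ∧ n ≤ d + 2 := by
  have hA1 : A ≠ 1 := by
    rintro rfl
    rw [E.val_one] at hA
    omega
  have hAi : Irreducible A := E.irreducible_of_val_lt hα hA1 (by omega)
  have hv : E.val (A ^ (d + 2)) = α * (d + 2) := by
    rw [E.val_pow, hA, mul_comm]
  have hge : α + β ≤ E.val (A ^ (d + 2)) := by
    rw [hv]
    linarith
  refine ⟨?_, ?_, fun n hn => ⟨?_, ?_⟩⟩
  · obtain ⟨w, hw⟩ := E.atom_dvd _ hge
    have hwv := E.val_mul E.atom w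
    rw [← hw, hv, E.val_atom] at hwv
    -- Here `w` has valuation `α * (d + 2) - β`, less than `2 * α` because `α * d < β`.
    have hwi : Irreducible w := by
      refine E.irreducible_of_val_lt hα ?_ (by linarith)
      rintro rfl
      rw [E.val_one] at hwv
      linarith
    refine (E.mem_lengthSet hα).2 ⟨{E.atom, w}, ?_, by simp [hw], by simp⟩
    simp only [Multiset.insert_eq_cons, Multiset.mem_cons, Multiset.mem_singleton]
    rintro u (rfl | rfl)
    exacts [E.irreducible_atom, hwi]
  · refine (E.mem_lengthSet hα).2 ⟨Multiset.replicate (d + 2) A, fun u hu => ?_,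
      Multiset.prod_replicate _ _, Multiset.card_replicate _ _⟩
    rwa [Multiset.eq_of_mem_replicate hu]
  · obtain ⟨s, hs, hsx, rfl⟩ := (E.mem_lengthSet hα).1 hn
    by_contra! hlt
    rcases Nat.le_one_iff_eq_zero_or_eq_one.1 (Nat.lt_succ_iff.1 hlt) with h0 | h1
    · rw [Multiset.card_eq_zero.1 h0, Multiset.prod_zero] at hsx
      rw [← hsx, E.val_one] at hge
      omega
    · obtain ⟨y, rfl⟩ := Multiset.card_eq_one.1 h1
      have := E.val_lt_of_irreducible hα (hα.trans hαβ) (hs y (by simp))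
      rw [← hsx, Multiset.prod_singleton] at hge
      omega
  · have := E.le_val_of_mem_lengthSet hα hn
    rw [hv, mul_comm] at this
    exact Nat.le_of_mul_le_mul_left this hα

/-- A factorization of `A ^ (d + 2)` that involves `atom` has length at most `2`. -/
theorem card_le_two_of_atom_mem (E : AtomExtraction M α β) {d : ℕ}
    (hd' : α * d < β) {A : M} (hA : E.val A = α) {s : Multiset M}
    (hs : ∀ u ∈ s, Irreducible u) (hsx : s.prod = A ^ (d + 2)) (hmem : E.atom ∈ s) :
    s.card ≤ 2 := by
  obtain ⟨t, rfl⟩ := Multiset.exists_cons_of_mem hmem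
  have ht := E.card_mul_le_val fun u hu => hs u (Multiset.mem_cons_of_mem hu)
  have hv := congrArg E.val hsx
  rw [Multiset.prod_cons, E.val_mul, E.val_atom, E.val_pow, hA] at hv
  rw [Multiset.card_cons]
  by_contra! hc
  have : 2 * α ≤ t.card * α := Nat.mul_le_mul_right α (by omega)
  nlinarith

end AtomExtraction

section LocalSingular

variable {N : Submonoid ℕ} {p α β f : ℕ}

/-- An irreducible `p ^ i * q ^ j` with `i > α * j` is `p ^ β`, where `p ^ α * q` lies in the
monoid and `2 * α < β`. -/
theorem eq_pow_of_irreducible_of_lt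
    (hN : ∀ x, x ∈ N ↔ x = 1 ∨ (0 < x ∧ p ^ α ∣ x ∧ x ≡ 1 [MOD f])) (hp : p.Prime)
    (hα : 0 < α) (hβ : IsLeast {k : ℕ | 0 < k ∧ p ^ k ∈ N} β) (h2 : 2 * α < β) {q i j : ℕ}
    (hq : q.Prime) (hpq : p ≠ q) (hA : p ^ α * q ≡ 1 [MOD f]) {y : N} (hy : Irreducible y)
    (hyij : (y : ℕ) = p ^ i * q ^ j) (hij : α * j < i) : (y : ℕ) = p ^ β := by
  have hval : (y : ℕ).factorization p = i := by
    rw [hyij, Nat.factorization_mul (pow_pos hp.pos _).ne' (pow_pos hq.pos _).ne']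
    simp [hp.factorization, hq.factorization, hpq.symm]
  have hlt : i < α + β := by
    have := (localSingularExtraction hp hN hβ).val_lt_of_irreducible hα hβ.1.1 hy
    change (y : ℕ).factorization p < α + β at this
    rwa [hval] at this
  -- Cancel `(p ^ α * q) ^ j`, which is `1` modulo `f`.
  have hpow : p ^ (i - α * j) ≡ 1 [MOD f] := by
    refine modEq_one_of_mul_modEq_one (x := (p ^ α * q) ^ j) (by simpa using hA.pow j) ?_
    have : (p ^ α * q) ^ j * p ^ (i - α * j) = y := by
      rw [hyij, mul_pow, ← pow_mul, mul_right_comm, ← pow_add, Nat.add_sub_cancel' hij.le]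
    rw [this]
    exact modEq_one_of_mem hN y.2
  have hle := le_of_pow_modEq_one hN hp hβ h2.le (by omega) hpow
  have hj : j = 0 := by
    by_contra hj
    have : α ≤ α * j := Nat.le_mul_of_pos_right α (Nat.pos_of_ne_zero hj)
    omega
  subst hj
  rw [mul_zero, Nat.sub_zero] at hle hpow
  rcases Nat.eq_or_lt_of_le hle with h | h
  · rw [hyij, h, pow_zero, mul_one]
  · exfalso
    have hpow' : p ^ (i - β) ≡ 1 [MOD f] := by
      refine modEq_one_of_mul_modEq_one (modEq_one_of_mem hN hβ.1.2) ?_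
      rwa [← pow_add, Nat.add_sub_cancel' hle]
    have := le_of_pow_modEq_one hN hp hβ h2.le (by omega) hpow'
    omega

theorem exists_lengthSet_eq
    (hN : ∀ x, x ∈ N ↔ x = 1 ∨ (0 < x ∧ p ^ α ∣ x ∧ x ≡ 1 [MOD f])) (hp : p.Prime)
    (hα : 0 < α) (hf : 0 < f) (hpf : Nat.Coprime p f)
    (hβ : IsLeast {k : ℕ | 0 < k ∧ p ^ k ∈ N} β) (hαβ : α < β) {d : ℕ} (hd0 : 0 < d)
    (hd : β ≤ α * (d + 1)) (hd' : α * d < β) : ∃ x : N, lengthSet x = {2, d + 2} := by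
  obtain ⟨q, hq, hpq, hA⟩ := exists_prime_pow_mul_modEq_one (α := α) hf hpf
  set E := localSingularExtraction hp hN hβ with hE
  have hAN : p ^ α * q ∈ N :=
    (hN _).2 (Or.inr ⟨Nat.mul_pos (pow_pos hp.pos α) hq.pos, Dvd.intro _ rfl, hA⟩)
  have hfacp : ∀ i j, (p ^ i * q ^ j).factorization p = i := fun i j => by
    rw [Nat.factorization_mul (pow_pos hp.pos _).ne' (pow_pos hq.pos _).ne']
    simp [hp.factorization, hq.factorization, hpq.symm]
  set A : N := ⟨p ^ α * q, hAN⟩ with hAdef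
  have hAv : E.val A = α := by
    have := hfacp α 1
    rwa [pow_one] at this
  obtain ⟨h2, h3, hbd⟩ := E.two_mem_lengthSet_pow hα hαβ hd hd' hAv
  refine ⟨A ^ (d + 2), Set.Subset.antisymm (fun n hn => ?_) ?_⟩
  swap
  · rintro n (rfl | rfl)
    exacts [h2, h3]
  obtain ⟨hn2, hnd⟩ := hbd n hn
  -- For `d = 1` the bounds leave only the lengths `2` and `3`; for `d ≥ 2` one has `2 * α < β`.
  rcases Nat.eq_or_lt_of_le (Nat.succ_le_of_lt hd0) with rfl | hd1
  · simp only [Set.mem_insert_iff, Set.mem_singleton_iff]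
    omega
  have h2α : 2 * α < β := by nlinarith
  obtain ⟨s, hs, hsx, rfl⟩ := (E.mem_lengthSet hα).1 hn
  by_cases hmem : E.atom ∈ s
  · have := E.card_le_two_of_atom_mem hd' hAv hs hsx hmem
    left
    omega
  right
  have hform : ∀ y ∈ s, ∃ i j, (y : ℕ) = p ^ i * q ^ j ∧ i ≤ α * j := by
    intro y hy
    have hdvd : (y : ℕ) ∣ p ^ (α * (d + 2)) * q ^ (d + 2) := by
      have h1 : y ∣ A ^ (d + 2) := hsx ▸ Multiset.dvd_prod hy
      have h2 := map_dvd N.subtype h1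
      rwa [map_pow, show N.subtype A = p ^ α * q from rfl, mul_pow, ← pow_mul] at h2
    obtain ⟨y₁, y₂, h1, h2, h12⟩ := exists_dvd_and_dvd_of_dvd_mul hdvd
    obtain ⟨i, -, rfl⟩ := (Nat.dvd_prime_pow hp).1 h1
    obtain ⟨j, -, rfl⟩ := (Nat.dvd_prime_pow hq).1 h2
    refine ⟨i, j, h12, ?_⟩
    by_contra! hij
    have := eq_pow_of_irreducible_of_lt hN hp hα hβ h2α hq hpq hA (hs y hy) h12 hij
    exact hmem ((Subtype.ext this : y = E.atom) ▸ hy)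
  have hfacq : ∀ i j, (p ^ i * q ^ j).factorization q = j := fun i j => by
    rw [Nat.factorization_mul (pow_pos hp.pos _).ne' (pow_pos hq.pos _).ne']
    simp [hp.factorization, hq.factorization, hpq]
  -- the `p`-adic valuation is at most `α` times the `q`-adic one, with equality for `A ^ (d + 2)`
  have hmulq : ∀ x y : N, ((x * y : N) : ℕ).factorization q =
      (x : ℕ).factorization q + (y : ℕ).factorization q := fun x y => by
    rw [Submonoid.coe_mul, Nat.factorization_mul (ne_zero_of_mem hN x) (ne_zero_of_mem hN y)]
    rfl
  have hle : ∀ t ≤ s, E.val t.prod ≤ α * (t.prod : ℕ).factorization q := by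
    intro t
    induction t using Multiset.induction_on with
    | empty => intro _; simp [E.val_one]
    | cons y t ih =>
      intro ht
      obtain ⟨i, j, hij, hle⟩ := hform y (Multiset.mem_of_le ht (Multiset.mem_cons_self y t))
      have hyv : E.val y = i := by
        change (y : ℕ).factorization p = i
        rw [hij, hfacp]
      have := ih ((Multiset.le_cons_self t y).trans ht)
      rw [Multiset.prod_cons, E.val_mul, hmulq, mul_add, hyv, hij, hfacq]
      omega
  have hvx : E.val s.prod = α * (d + 2) := by rw [hsx, E.val_pow, hAv, mul_comm]
  have hqx : (s.prod : ℕ).factorization q = d + 2 := by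
    rw [hsx]
    change ((p ^ α * q) ^ (d + 2)).factorization q = d + 2
    rw [mul_pow, ← pow_mul, hfacq]
  have hall : ∀ y ∈ s, E.val y = α := by
    intro y hy
    obtain ⟨i, j, hij, hyle⟩ := hform y hy
    obtain ⟨t, rfl⟩ := Multiset.exists_cons_of_mem hy
    have ht := hle t (Multiset.le_cons_self t y)
    have hyv : E.val y = i := by
      change (y : ℕ).factorization p = i
      rw [hij, hfacp]
    rw [Multiset.prod_cons, E.val_mul, hyv] at hvx
    rw [Multiset.prod_cons, hmulq, hij, hfacq] at hqx
    -- The inequalities for `y` and for the remaining factors add up to an equality, so both are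
    -- tight. Then `y` is a power of `A`, and irreducibility makes it `A`.
    have hi : i = α * j := by
      rw [← hqx, mul_add] at hvx
      omega
    have hyA : y = A ^ j := Subtype.ext (by
      rw [hij, hi, pow_mul, ← mul_pow]; rfl)
    have hj : j = 1 := by
      have := hs y hy
      rw [hyA] at this
      by_contra hj
      exact not_irreducible_pow hj this
    rw [hyv, hi, hj, mul_one]
  have hcard : ∀ t ≤ s, E.val t.prod = α * t.card := by
    intro t
    induction t using Multiset.induction_on with
    | empty => intro _; simp [E.val_one]
    | cons y t ih =>
      intro ht
      rw [Multiset.prod_cons, E.val_mul, Multiset.card_cons,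
        ih ((Multiset.le_cons_self t y).trans ht),
        hall y (Multiset.mem_of_le ht (Multiset.mem_cons_self y t))]
      ring
  exact Nat.eq_of_mul_eq_mul_left hα ((hcard s le_rfl).symm.trans hvx)

end LocalSingular

theorem proposition4p6 (a b p α β : ℕ) (ha : 0 < a) (hab : a ≤ b) (hmul : a ^ 2 ≡ a [MOD b])
    (hp : p.Prime) (hα : 0 < α) (hd : Nat.gcd a b = p ^ α)
    (hβ : β = leastExponent (ACM a b hmul) p) (hne : α ≠ β) :
    (lengthIdeal (ACM a b hmul)).Nonempty ∧ 0 < largestBelow α β ∧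
      lengthDensity (ACM a b hmul) = 1 / (largestBelow α β : ℝ) := by
  have hleast : IsLeast {k : ℕ | 0 < k ∧ p ^ k ∈ ACM a b hmul} β :=
    hβ ▸ isLeast_leastExponent ha hab hmul hp hα hd
  obtain ⟨f, hf, hpf, hN⟩ := exists_mem_ACM_iff ha hab hmul hp hα hd
  have hαβ : α < β := by
    refine lt_of_le_of_ne ?_ hne
    exact (Nat.pow_dvd_pow_iff_le_right hp.one_lt).1
      (dvd_of_mem hN hleast.1.2 (Nat.one_lt_pow hleast.1.1.ne' hp.one_lt).ne')
  have hα' : (0 : ℝ) < α := by exact_mod_cast hα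
  obtain ⟨hmem, hub⟩ := isGreatest_largestBelow α β
  have hpos : 0 < largestBelow α β := by
    have : (1 : ℤ) ≤ largestBelow α β := hub (by
      change ((1 : ℤ) : ℝ) < (β : ℝ) / α
      rw [lt_div_iff₀ hα']
      simpa using hαβ)
    omega
  obtain ⟨d, hdeq⟩ := Int.eq_ofNat_of_zero_le hpos.le
  have hd' : α * d < β := by
    change ((largestBelow α β : ℤ) : ℝ) < (β : ℝ) / α at hmem
    rw [hdeq, lt_div_iff₀ hα', Int.cast_natCast] at hmem
    rw [mul_comm]
    exact_mod_cast hmem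
  have hd1 : β ≤ α * (d + 1) := by
    by_contra! hc
    have : ((d : ℤ) + 1) ≤ largestBelow α β := hub (by
      change (((d : ℤ) + 1 : ℤ) : ℝ) < (β : ℝ) / α
      rw [lt_div_iff₀ hα', mul_comm]
      exact_mod_cast hc)
    omega
  have hd0 : 0 < d := by omega
  obtain ⟨x, hx⟩ := exists_lengthSet_eq hN hp hα hf hpf hleast hαβ hd0 hd1 hd'
  obtain ⟨h1, h2⟩ :=
    (localSingularExtraction hp hN hleast).lengthDensity_eq hα hαβ hd0 hd1 hx
  refine ⟨h1, hpos, ?_⟩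
  rw [h2, hdeq, Int.cast_natCast]
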